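/- A plane-bipartite graph $G$ is a finite graph (multiple edges allowed) drawn in a closed disk, with $n\ge 0$ boundary vertices $b_1,\dots,b_n$ on the boundary circle in clockwise order and with internal vertices in the open disk that are colored black or white, such that no edge joins two internal vertices of the same color or two boundary vertices, and each $b_i$ is incident to exactly one edge. Boundary vertices are uncolored; the boundary end of an edge is regarded as having the color opposite to that of its internal end. Let $E$ be the edge set. A perfect orientation $\mathcal O$ of $G$ is a choice of directions of the edges such that exactly one edge is directed away from each black internal vertex and exactly one edge is directed towards each white internal vertex; its source set $I_{\mathcal O}\subseteq[n]$ is the set of $i$ such that $b_i$ is a source. An almost perfect matching is a set of edges $M$ such that each internal vertex is incident to exactly one edge of $M$. To $\mathcal O$ corresponds the matching $M_{\mathcal O}$ of the edges directed away from a black internal vertex or towards a white internal vertex. For a set $S$ write $\chi_S$ for its $0$-$1$ vector. Let $P(G)\subset\mathbb R^E$ be the convex hull of the vectors $\chi_M$, where $M$ ranges over the almost perfect matchings of $G$. A flow in $\mathcal O$ from $I_{\mathcal O}$ to $J\subseteq[n]$ is a collection of pairwise vertex-disjoint self-avoiding directed walks and directed cycles such that the set of sources of the walks is $I_{\mathcal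 O}\setminus J$ and the set of their destinations is $J\setminus I_{\mathcal O}$. Its weight is the product of the variables $x_e$ of its edges directed from white to black, divided by the product of the variables of its edges directed from black to white. The Plücker coordinates of the boundary measurement map of $G$ (computed from $\mathcal O$, after clearing the common denominator) are expressed in the edge variables by the Laurent polynomials $p_J^{\mathcal O}=\sum_F \mathrm{weight}(F)$, where $F$ ranges over the flows from $I_{\mathcal O}$ to $J$; here $p^{\mathcal O}_J$ denotes this Laurent polynomial. The Newton polytope $\mathrm{Newt}(p)$ is the convex hull of the exponent vectors of the monomials with nonzero coefficient in $p$. **Proposition.** Let $G$ be a plane-bipartite graph that has a perfect orientation. Then the source sets of the perfect orientations of $G$ are the bases of a matroid $M_G$ on $[n]$ (the positroid of $G$). Let $Q(M_G)\subset\mathbb R^n$ be its matroid polytope, the convex hull of the vectors $\chi_J$ with $J$ a basis of $M_G$; its vertices are exactly these vectors $\chi_J$. The map $\mathcal O\mapsto M_{\mathcal O}$ is a bijection from perfect orientations to almost perfect matchings, and there is a linear map $\Psi:\mathbb R^E\to\mathbb R^n$ such that: 1. $\Psi(P(G))=Q(M_G)$. 2. $\Psi(\chi_{M_{\mathcal O}})=\chi_{I_{\mathcal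 O}}$ for every perfect orientation $\mathcal O$. In particular, if all boundary vertices are black (each is joined to a white vertex), then $\Psi$ sends $\chi_M$, for every almost perfect matching $M$, to the $0$-$1$ vector of the set of boundary vertices that belong to an edge of $M$. 3. For every perfect orientation $\mathcal O$ and every basis $J$ of $M_G$, the fiber of $\Psi$ over the vertex $\chi_J$ is, up to a translation by an integer vector that does not depend on $J$, the Newton polytope of $p^{\mathcal O}_J$: $$\{x\in P(G) : \Psi(x)=\chi_J\}=\chi_{M_{\mathcal O}}+\mathrm{Newt}(p^{\mathcal O}_J).$$ -/

import Mathlib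

namespace PlaneBipartite

/-- The two colors of internal vertices. -/
inductive VertexColor where
  | black : VertexColor
  | white : VertexColor

/-- The underlying combinatorial data of a plane-bipartite graph with internal vertices `V`,
boundary vertices `b_i` (`i : Fin n`) and edges `E` (multiple edges are allowed). The vertices are
`V ⊕ Fin n`. Every edge has a black end and a white end; boundary vertices are not colored, and
the boundary end of an edge is the end opposite in color to its internal end. -/
structure BoundaryGraph (n : ℕ) (V E : Type*) where
  /-- the color of an internal vertex -/
  color : V → VertexColor
  /-- the black end of an edge -/
  blackEnd : E → V ⊕ Fin n
  /-- the white end of an edge -/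
  whiteEnd : E → V ⊕ Fin n
  color_blackEnd : ∀ e v, blackEnd e = Sum.inl v → color v = VertexColor.black
  color_whiteEnd : ∀ e v, whiteEnd e = Sum.inl v → color v = VertexColor.white
  /-- no edge joins two (uncolored) boundary vertices -/
  exists_internal : ∀ e, ∃ v : V, blackEnd e = Sum.inl v ∨ whiteEnd e = Sum.inl v
  /-- each boundary vertex is incident to a single edge -/
  boundary_edge : ∀ i : Fin n,
    ∃! e, blackEnd e = Sum.inr i ∨ whiteEnd e = Sum.inr i

/-- A plane-bipartite graph: a `BoundaryGraph` drawn in the closed unit disk of `ℂ`, with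
`b_1, …, b_n` on the unit circle in clockwise order, internal vertices strictly inside, and edges
drawn as simple arcs that meet each other only in common end points. -/
structure PlaneBipartiteGraph (n : ℕ) (V E : Type*) extends BoundaryGraph n V E where
  /-- the position of a vertex -/
  pos : V ⊕ Fin n → ℂ
  pos_injective : Function.Injective pos
  pos_internal : ∀ v : V, ‖pos (Sum.inl v)‖ < 1
  /-- the angles of the boundary vertices decrease, within one full turn -/
  pos_boundary : ∃ θ : Fin n → ℝ, StrictAnti θ ∧ (∀ i j, θ i < θ j + 2 * Real.pi) ∧
    ∀ i, pos (Sum.inr i) = Complex.exp ((θ i : ℂ) * Complex.I)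
  /-- the arc that draws an edge -/
  arc : ∀ e : E, Path (pos (blackEnd e)) (pos (whiteEnd e))
  arc_injective : ∀ e, Function.Injective (arc e)
  arc_inside : ∀ (e : E) (t : unitInterval), 0 < t → t < 1 →
    ‖arc e t‖ < 1 ∧ arc e t ∉ Set.range pos
  arc_disjoint : ∀ (e e' : E) (s t : unitInterval), e ≠ e' →
    0 < s → s < 1 → 0 < t → t < 1 → arc e s ≠ arc e' t

/-- A choice of directions of the edges: `true` means that the edge is directed from its black end
to its white end, `false` that it is directed from its white end to its black end. -/
abbrev Orientation (E : Type*) := E → Bool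

/-- The 0-1 vector of a set. -/
noncomputable def charVec {ι : Type*} (s : Set ι) : ι → ℝ := s.indicator 1

namespace BoundaryGraph

variable {n : ℕ} {V E : Type*}

/-- The edge `e` is incident to the vertex `a`. -/
def Incident (G : BoundaryGraph n V E) (e : E) (a : V ⊕ Fin n) : Prop :=
  G.blackEnd e = a ∨ G.whiteEnd e = a

/-- The vertex from which `e` is directed away. -/
def tail (G : BoundaryGraph n V E) (O : Orientation E) (e : E) : V ⊕ Fin n :=
  if O e then G.blackEnd e else G.whiteEnd e

/-- The vertex towards which `e` is directed. -/
def head (G : BoundaryGraph n V E) (O : Orientation E) (e : E) : V ⊕ Fin n :=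
  if O e then G.whiteEnd e else G.blackEnd e

/-- Perfect orientations: exactly one edge is directed away from each black internal vertex, and
exactly one edge is directed towards each white internal vertex. -/
def IsPerfectOrientation (G : BoundaryGraph n V E) (O : Orientation E) : Prop :=
  (∀ u : V, G.color u = VertexColor.black → ∃! e, G.tail O e = Sum.inl u) ∧
  (∀ v : V, G.color v = VertexColor.white → ∃! e, G.head O e = Sum.inl v)

/-- `G` has a perfect orientation. -/
def PerfectlyOrientable (G : BoundaryGraph n V E) : Prop :=
  ∃ O, G.IsPerfectOrientation O

/-- The source set `I_O`: the indices of the boundary vertices that are sources. -/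
def sourceSet (G : BoundaryGraph n V E) (O : Orientation E) : Set (Fin n) :=
  {i | ∃ e, G.tail O e = Sum.inr i}

/-- Almost perfect matchings: each internal vertex is incident to exactly one edge of `M`. -/
def IsAlmostPerfectMatching (G : BoundaryGraph n V E) (M : Set E) : Prop :=
  ∀ v : V, ∃! e, e ∈ M ∧ G.Incident e (Sum.inl v)

/-- The matching that corresponds to a perfect orientation: the edges directed away from a black
internal vertex or towards a white internal vertex. -/
def matchingOf (G : BoundaryGraph n V E) (O : Orientation E) : Set E :=
  {e | (∃ u : V, G.color u = VertexColor.black ∧ G.tail O e = Sum.inl u) ∨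
       (∃ v : V, G.color v = VertexColor.white ∧ G.head O e = Sum.inl v)}

/-- The boundary vertices that belong to an edge of `M`. -/
def matchedBoundary (G : BoundaryGraph n V E) (M : Set E) : Set (Fin n) :=
  {i | ∃ e ∈ M, G.Incident e (Sum.inr i)}

/-- All boundary vertices can be regarded as black, i.e. each is joined to a white vertex. -/
def BoundaryBlack (G : BoundaryGraph n V E) : Prop :=
  ∀ e i, G.whiteEnd e ≠ Sum.inr i

/-- The matching polytope `P(G)` in `ℝ^E`. -/
def matchingPolytope (G : BoundaryGraph n V E) : Set (E → ℝ) :=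
  convexHull ℝ {x | ∃ M, G.IsAlmostPerfectMatching M ∧ x = charVec M}

/-- `p` is the list of edges of a directed walk from `a` to `b`. -/
def IsWalk (G : BoundaryGraph n V E) (O : Orientation E) :
    V ⊕ Fin n → List E → V ⊕ Fin n → Prop
  | a, [], b => a = b
  | a, e :: p, b => G.tail O e = a ∧ G.IsWalk O (G.head O e) p b

/-- `C` is the edge set of a directed self-avoiding walk from `a` to `b`. -/
def IsSelfAvoidingWalk (G : BoundaryGraph n V E) (O : Orientation E) (a b : V ⊕ Fin n)
    (C : Set E) : Prop :=
  ∃ p : List E, G.IsWalk O a p b ∧ (a :: p.map (G.head O)).Nodup ∧ C = {e | e ∈ p}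

/-- `C` is the edge set of a directed self-avoiding cycle. -/
def IsCycle (G : BoundaryGraph n V E) (O : Orientation E) (C : Set E) : Prop :=
  ∃ (a : V ⊕ Fin n) (p : List E), p ≠ [] ∧ G.IsWalk O a p a ∧ (p.map (G.head O)).Nodup ∧
    C = {e | e ∈ p}

/-- `F` is a flow from `I_O` to `J`: a collection of pairwise vertex-disjoint self-avoiding directed
walks and cycles (each given by its edge set) such that the sources of the walks are `I_O \ J` and
the destinations are `J \ I_O`. -/
def IsFlow (G : BoundaryGraph n V E) (O : Orientation E) (J : Set (Fin n))
    (F : Set (Set E)) : Prop :=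
  (∀ C ∈ F, G.IsCycle O C ∨ ∃ i ∈ G.sourceSet O \ J, ∃ j ∈ J \ G.sourceSet O,
    G.IsSelfAvoidingWalk O (Sum.inr i) (Sum.inr j) C) ∧
  (∀ C ∈ F, ∀ D ∈ F, C ≠ D → ∀ c ∈ C, ∀ d ∈ D, ∀ a, ¬ (G.Incident c a ∧ G.Incident d a)) ∧
  (∀ i ∈ G.sourceSet O \ J, ∃ C ∈ F, ∃ j, G.IsSelfAvoidingWalk O (Sum.inr i) (Sum.inr j) C) ∧
  (∀ j ∈ J \ G.sourceSet O, ∃ C ∈ F, ∃ i, G.IsSelfAvoidingWalk O (Sum.inr i) (Sum.inr j) C)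

open Classical in
/-- The exponent vector of the weight of a flow: each edge of the flow that is directed from its
white to its black end has exponent `1`, each edge of the flow that is directed from its black to
its white end has exponent `-1`. -/
noncomputable def flowExponent (O : Orientation E) (F : Set (Set E)) : E → ℤ :=
  fun e => if ∃ C ∈ F, e ∈ C then (if O e then -1 else 1) else 0

open Classical in
/-- The Plücker coordinate `p_J = ∑ weight(F)`, summed over all flows `F` from `I_O` to `J`, as a
Laurent polynomial in the edge variables `x_e`. -/
noncomputable def pluckerLaurent [Fintype E] (G : BoundaryGraph n V E) (O : Orientation E)
    (J : Set (Fin n)) : AddMonoidAlgebra ℤ (E → ℤ) :=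
  ∑ F ∈ Finset.univ.filter (fun F : Set (Set E) => G.IsFlow O J F),
    AddMonoidAlgebra.single (flowExponent O F) 1

/-- `M` is the positroid `M_G`: the matroid on `[n]` whose bases are the source sets of the perfect
orientations of `G`. -/
def IsPositroidOf (M : Matroid (Fin n)) (G : BoundaryGraph n V E) : Prop :=
  M.E = Set.univ ∧ ∀ B, M.IsBase B ↔ ∃ O, G.IsPerfectOrientation O ∧ G.sourceSet O = B

end BoundaryGraph

/-- The matroid polytope `Q(M)`. -/
def matroidPolytope {α : Type*} (M : Matroid α) : Set (α → ℝ) :=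
  convexHull ℝ {x | ∃ B, M.IsBase B ∧ x = charVec B}

/-- The Newton polytope of a Laurent polynomial: the convex hull of the exponent vectors of the
monomials with nonzero coefficient. -/
def newtonPolytope {E : Type*} (p : AddMonoidAlgebra ℤ (E → ℤ)) : Set (E → ℝ) :=
  convexHull ℝ {x | ∃ m : E → ℤ, p.coeff m ≠ 0 ∧ x = fun e => (m e : ℝ)}

end PlaneBipartite

namespace PlaneBipartite

open VertexColor

namespace BoundaryGraph

variable {n : ℕ} {V E : Type*} (G : BoundaryGraph n V E)

/-! ### Incidences and colors -/

/-! Since `O e = true` means "from black to white", a perfect orientation is the same as a choice of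
exactly one `true` edge at each internal vertex (`isPerfectOrientation_iff`). So the matching of `O`
is the set of its `true` edges, which gives the bijection.

The edges on which two perfect orientations `O`, `O'` differ form a `Balanced` set: at each internal
vertex either no edge, or one incoming and one outgoing. Such a set splits into vertex-disjoint
directed cycles and walks between boundary vertices (`Balanced.exists_decomposition`), hence is a
flow from the source set of `O` to that of `O'`. Conversely, reversing a flow to `J` yields a
perfect orientation with source set `J`, and the reversal adds exactly the exponent vector of the
flow to the matching vector (`charVec_add_flowExponent`). Reversing a single walk of a flow gives
the basis exchange.

On matching vectors, being a source is a linear condition in the edges near `b_i`, which defines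
`projection`. As 0-1 vectors are extreme in the unit cube, a fiber over one of them is spanned by
the matchings lying over it (`fiber_convexHull_eq`), and these are the translated flow exponents. -/

lemma incident_iff_tail_or_head (O : Orientation E) (e : E) (a : V ⊕ Fin n) :
    G.Incident e a ↔ G.tail O e = a ∨ G.head O e = a := by
  unfold Incident tail head
  cases O e <;> simp [or_comm]

lemma exists_incident_boundary (i : Fin n) : ∃ e, G.Incident e (Sum.inr i) :=
  (G.boundary_edge i).exists

variable {G}

lemma incident_tail (O : Orientation E) (e : E) : G.Incident e (G.tail O e) :=
  (G.incident_iff_tail_or_head O e _).2 (Or.inl rfl)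

lemma incident_head (O : Orientation E) (e : E) : G.Incident e (G.head O e) :=
  (G.incident_iff_tail_or_head O e _).2 (Or.inr rfl)

lemma Incident.boundary_unique {e e' : E} {i : Fin n} (h : G.Incident e (Sum.inr i))
    (h' : G.Incident e' (Sum.inr i)) : e = e' :=
  (G.boundary_edge i).unique h h'

lemma not_tail_head_boundary {O : Orientation E} {e e' : E} {i : Fin n}
    (h : G.tail O e = Sum.inr i) (h' : G.head O e' = Sum.inr i) : False := by
  have : e = e' := Incident.boundary_unique (h ▸ incident_tail O e) (h' ▸ incident_head O e')
  subst this
  obtain ⟨v, hv⟩ := G.exists_internal e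
  unfold tail at h
  unfold head at h'
  cases hO : O e <;> simp_all

lemma blackEnd_eq_of_incident {e : E} {v : V} (h : G.Incident e (Sum.inl v))
    (hv : G.color v = black) : G.blackEnd e = Sum.inl v := by
  rcases h with h | h
  · exact h
  · have := G.color_whiteEnd e v h
    simp_all

lemma whiteEnd_eq_of_incident {e : E} {v : V} (h : G.Incident e (Sum.inl v))
    (hv : G.color v = white) : G.whiteEnd e = Sum.inl v := by
  rcases h with h | h
  · have := G.color_blackEnd e v h
    simp_all
  · exact h

/-- All edges at an internal vertex have the same color there, so the value of `O` alone decides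
which of them leave it. Local conditions thereby become statements about `Incident` and `O`. -/
lemma tail_eq_internal_iff {O : Orientation E} {e : E} {v : V} :
    G.tail O e = Sum.inl v ↔
      G.Incident e (Sum.inl v) ∧ (O e = true ↔ G.color v = black) := by
  constructor
  · intro h
    refine ⟨h ▸ incident_tail O e, ?_⟩
    unfold tail at h
    cases hO : O e
    · simp only [hO] at h
      simp [G.color_whiteEnd e v (by simpa using h)]
    · simp only [hO] at h
      simp [G.color_blackEnd e v (by simpa using h)]
  · rintro ⟨h, h'⟩
    unfold tail
    cases hv : G.color v
    · simp [h'.2 hv, blackEnd_eq_of_incident h hv]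
    · have : O e = false := by simpa [hv] using h'
      simp [this, whiteEnd_eq_of_incident h hv]

lemma head_eq_internal_iff {O : Orientation E} {e : E} {v : V} :
    G.head O e = Sum.inl v ↔
      G.Incident e (Sum.inl v) ∧ (O e = true ↔ G.color v = white) := by
  constructor
  · intro h
    refine ⟨h ▸ incident_head O e, ?_⟩
    unfold head at h
    cases hO : O e
    · simp only [hO] at h
      simp [G.color_blackEnd e v (by simpa using h)]
    · simp only [hO] at h
      simp [G.color_whiteEnd e v (by simpa using h)]
  · rintro ⟨h, h'⟩
    unfold head
    cases hv : G.color v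
    · have : O e = false := by simpa [hv] using h'
      simp [this, blackEnd_eq_of_incident h hv]
    · simp [h'.2 hv, whiteEnd_eq_of_incident h hv]

/-! ### Perfect orientations and matchings -/

lemma isPerfectOrientation_iff {O : Orientation E} :
    G.IsPerfectOrientation O ↔
      ∀ v : V, ∃! e, G.Incident e (Sum.inl v) ∧ O e = true := by
  unfold IsPerfectOrientation
  simp only [tail_eq_internal_iff, head_eq_internal_iff]
  constructor
  · rintro ⟨h₁, h₂⟩ v
    cases hv : G.color v
    · simpa [hv] using h₁ v hv
    · simpa [hv] using h₂ v hv
  · intro h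
    exact ⟨fun u hu => by simpa [hu] using h u, fun u hu => by simpa [hu] using h u⟩

lemma matchingOf_eq (O : Orientation E) : G.matchingOf O = {e | O e = true} := by
  ext e
  simp only [matchingOf, Set.mem_ofPred_eq, tail_eq_internal_iff, head_eq_internal_iff]
  constructor
  · rintro (⟨u, hu, -, h⟩ | ⟨u, hu, -, h⟩)
    · exact h.2 hu
    · exact h.2 hu
  · intro hO
    obtain ⟨v, hv⟩ := G.exists_internal e
    cases hc : G.color v
    · exact Or.inl ⟨v, hc, hv, by simp [hO, hc]⟩
    · exact Or.inr ⟨v, hc, hv, by simp [hO, hc]⟩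

lemma isAlmostPerfectMatching_setOf_iff {O : Orientation E} :
    G.IsAlmostPerfectMatching {e | O e = true} ↔ G.IsPerfectOrientation O := by
  rw [isPerfectOrientation_iff]
  simp only [IsAlmostPerfectMatching, Set.mem_ofPred_eq, and_comm]

lemma isAlmostPerfectMatching_matchingOf {O : Orientation E} (hO : G.IsPerfectOrientation O) :
    G.IsAlmostPerfectMatching (G.matchingOf O) := by
  rw [matchingOf_eq]
  exact isAlmostPerfectMatching_setOf_iff.2 hO

lemma matchingOf_injective : Function.Injective G.matchingOf := by
  intro O O' h
  rw [matchingOf_eq, matchingOf_eq] at h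
  funext e
  exact Bool.eq_iff_iff.2 (Set.ext_iff.1 h e)

lemma existsUnique_orientation_of_matching {N : Set E} (hN : G.IsAlmostPerfectMatching N) :
    ∃! O, G.IsPerfectOrientation O ∧ G.matchingOf O = N := by
  classical
  have hN' : {e | (fun e => decide (e ∈ N)) e = true} = N := by ext; simp
  refine ⟨fun e => decide (e ∈ N), ⟨?_, ?_⟩, fun O' h => matchingOf_injective (G := G) ?_⟩
  · rw [← isAlmostPerfectMatching_setOf_iff, hN']
    exact hN
  · rw [matchingOf_eq, hN']
  · rw [h.2, matchingOf_eq, hN']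

lemma mem_sourceSet_iff {O : Orientation E} {e : E} {i : Fin n}
    (he : G.Incident e (Sum.inr i)) : i ∈ G.sourceSet O ↔ G.tail O e = Sum.inr i := by
  constructor
  · rintro ⟨e', he'⟩
    rwa [he.boundary_unique (he' ▸ incident_tail O e')]
  · exact fun h => ⟨e, h⟩

lemma tail_of_ne {O O' : Orientation E} {e : E} (h : O e ≠ O' e) :
    G.tail O' e = G.head O e := by
  unfold tail head
  cases hO : O e <;> cases hO' : O' e <;> simp_all

/-- A boundary vertex has a single edge, so reversing this edge is the only way to change whether
the vertex is a source. -/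
lemma ne_iff_sourceSet {O O' : Orientation E} {e : E} {i : Fin n}
    (he : G.Incident e (Sum.inr i)) :
    O e ≠ O' e ↔ ¬ (i ∈ G.sourceSet O ↔ i ∈ G.sourceSet O') := by
  rw [mem_sourceSet_iff he, mem_sourceSet_iff he]
  by_cases h : O e = O' e
  · simp [h, tail]
  · rw [tail_of_ne h]
    rcases (G.incident_iff_tail_or_head O e _).1 he with h' | h'
    · have : G.head O e ≠ Sum.inr i := fun h'' => not_tail_head_boundary h' h''
      simp [h, h', this]
    · have : G.tail O e ≠ Sum.inr i := fun h'' => not_tail_head_boundary h'' h'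
      simp [h, h', this]

lemma sourceSet_eq_matchedBoundary (hG : G.BoundaryBlack) (O : Orientation E) :
    G.sourceSet O = G.matchedBoundary (G.matchingOf O) := by
  rw [matchingOf_eq]
  ext i
  obtain ⟨e, he⟩ := G.exists_incident_boundary i
  have hb : G.blackEnd e = Sum.inr i := he.resolve_right (hG e i)
  rw [mem_sourceSet_iff he]
  constructor
  · intro h
    refine ⟨e, ?_, he⟩
    by_contra hO
    refine hG e i ?_
    simpa [tail, hO, show ¬ O e = true from hO] using h
  · rintro ⟨e', hO, he'⟩
    obtain rfl := he.boundary_unique he'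
    simpa [tail, show O e = true from hO] using hb

/-! ### Balanced edge sets -/

variable (G) in
/-- At each internal vertex, `D` has either no edge, or one edge directed towards the vertex and one
directed away from it. -/
def Balanced (O : Orientation E) (D : Set E) : Prop :=
  ∀ v : V, ∀ e ∈ D, G.Incident e (Sum.inl v) →
    (∀ e' ∈ D, G.Incident e' (Sum.inl v) → O e' = O e → e' = e) ∧
    ∃ e' ∈ D, G.Incident e' (Sum.inl v) ∧ O e' ≠ O e

open Classical in
/-- The orientation obtained by reversing the edges of `D`. -/
noncomputable def reverseOn (O : Orientation E) (D : Set E) : Orientation E :=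
  fun e => if e ∈ D then !O e else O e

lemma ne_reverseOn_iff {O : Orientation E} {D : Set E} {e : E} :
    O e ≠ reverseOn O D e ↔ e ∈ D := by
  unfold reverseOn
  by_cases h : e ∈ D <;> simp [h]

lemma reverseOn_setOf_ne (O O' : Orientation E) : reverseOn O {e | O e ≠ O' e} = O' := by
  funext e
  unfold reverseOn
  cases h : O e <;> cases h' : O' e <;> simp [h, h']

/-- At a vertex met by `D`, the two edges of `D` are the unique `true` edge and one `false` edge;
reversal exchanges their roles. -/
lemma Balanced.isPerfectOrientation {O : Orientation E} {D : Set E} (hD : G.Balanced O D)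
    (hO : G.IsPerfectOrientation O) : G.IsPerfectOrientation (reverseOn O D) := by
  rw [isPerfectOrientation_iff] at hO ⊢
  intro v
  obtain ⟨e₀, ⟨h₀, hO₀⟩, huniq⟩ := hO v
  by_cases h : e₀ ∈ D
  · obtain ⟨-, e₁, h₁D, h₁, hO₁⟩ := hD v e₀ h h₀
    have hO₁' : O e₁ = false := by simpa [hO₀] using hO₁
    refine ⟨e₁, ⟨h₁, by simp [reverseOn, h₁D, hO₁']⟩, ?_⟩
    rintro e ⟨he, heO⟩
    by_cases heD : e ∈ D
    · exact (hD v e₁ h₁D h₁).1 e heD he (by simpa [reverseOn, heD, hO₁'] using heO)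
    · have : e = e₀ := huniq e ⟨he, by simpa [reverseOn, heD] using heO⟩
      exact absurd (this ▸ h) heD
  · refine ⟨e₀, ⟨h₀, by simp [reverseOn, h, hO₀]⟩, ?_⟩
    rintro e ⟨he, heO⟩
    by_cases heD : e ∈ D
    · obtain ⟨-, e₁, h₁D, h₁, hO₁⟩ := hD v e heD he
      have hOe : O e = false := by simpa [reverseOn, heD] using heO
      have : e₁ = e₀ := huniq e₁ ⟨h₁, by simpa [hOe] using hO₁⟩
      exact absurd (this ▸ h₁D) h
    · exact huniq e ⟨he, by simpa [reverseOn, heD] using heO⟩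

/-- Let `e₀`, `e₁` be the `true` edges of `O`, `O'` at a vertex. If they coincide, nothing differs
there; otherwise exactly these two edges differ, and `O` takes opposite values on them. -/
lemma IsPerfectOrientation.balanced_ne {O O' : Orientation E} (hO : G.IsPerfectOrientation O)
    (hO' : G.IsPerfectOrientation O') : G.Balanced O {e | O e ≠ O' e} := by
  rw [isPerfectOrientation_iff] at hO hO'
  intro v e he hev
  obtain ⟨e₀, ⟨h₀, hO₀⟩, huniq⟩ := hO v
  obtain ⟨e₁, ⟨h₁, hO₁⟩, huniq'⟩ := hO' v
  simp only [Set.mem_ofPred_eq] at he ⊢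
  cases hOe : O e
  · have hO'e : O' e = true := by simpa [hOe] using he
    obtain rfl := huniq' e ⟨hev, hO'e⟩
    refine ⟨fun e' he' hev' h => huniq' e' ⟨hev', by simpa [h] using he'⟩,
      e₀, ?_, h₀, by simp [hO₀]⟩
    intro h
    have := huniq' e₀ ⟨h₀, by rw [← h, hO₀]⟩
    simp_all
  · have hO'e : O' e = false := by simpa [hOe] using he
    obtain rfl := huniq e ⟨hev, hOe⟩
    refine ⟨fun e' he' hev' h => huniq e' ⟨hev', h⟩, e₁, ?_, h₁, ?_⟩
    · intro h
      have := huniq e₁ ⟨h₁, by rw [h, hO₁]⟩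
      simp_all
    · intro h
      have := huniq e₁ ⟨h₁, h⟩
      simp_all

/-- A balanced subset of a balanced set is a union of connected components. -/
lemma Balanced.mem_of_incident {O : Orientation E} {C D : Set E} (hC : G.Balanced O C)
    (hD : G.Balanced O D) (hCD : C ⊆ D) {c d : E} (hc : c ∈ C) (hd : d ∈ D)
    {a : V ⊕ Fin n} (hca : G.Incident c a) (hda : G.Incident d a) : d ∈ C := by
  rcases a with v | i
  -- `C` already has an edge of each direction at `v`, and `D` has only one of each, so `d` is one
  -- of them.
  · by_cases h : O d = O c
    · rwa [(hD v c (hCD hc) hca).1 d hd hda h]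
    · obtain ⟨-, c', hc', hcv', h'⟩ := hC v c hc hca
      have : O d = O c' := by
        cases h1 : O d <;> cases h2 : O c <;> cases h3 : O c' <;> simp_all
      rwa [(hD v c' (hCD hc') hcv').1 d hd hda this]
  · rwa [hda.boundary_unique hca]

lemma Balanced.diff {O : Orientation E} {C D : Set E} (hC : G.Balanced O C)
    (hD : G.Balanced O D) (hCD : C ⊆ D) : G.Balanced O (D \ C) := by
  rintro v e ⟨he, heC⟩ hev
  obtain ⟨h, e', he', hev', hO⟩ := hD v e he hev
  exact ⟨fun f hf => h f hf.1,
    e', ⟨he', fun h => heC (hC.mem_of_incident hD hCD h he hev' hev)⟩, hev', hO⟩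

lemma balanced_sUnion {O : Orientation E} {F : Set (Set E)} (hF : ∀ C ∈ F, G.Balanced O C)
    (hdisj : ∀ C ∈ F, ∀ D ∈ F, C ≠ D → ∀ c ∈ C, ∀ d ∈ D, ∀ a,
      ¬ (G.Incident c a ∧ G.Incident d a)) : G.Balanced O (⋃₀ F) := by
  rintro v e ⟨C, hC, he⟩ hev
  obtain ⟨h, e', he', hev', hO⟩ := hF C hC v e he hev
  refine ⟨?_, e', ⟨C, hC, he'⟩, hev', hO⟩
  rintro f ⟨D, hD, hf⟩ hfv hO'
  by_cases hCD : C = D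
  · subst hCD
    exact h f hf hfv hO'
  · exact absurd ⟨hev, hfv⟩ (hdisj C hC D hD hCD e he f hf _)

/-- Injectivity bounds in- and out-degrees in `D` by one, and `hth` makes them equal at internal
vertices. This is how walks and cycles are recognized as balanced. -/
lemma balanced_of_tail_head {O : Orientation E} {D : Set E} (ht : Set.InjOn (G.tail O) D)
    (hh : Set.InjOn (G.head O) D)
    (hth : ∀ v : V, (∃ e ∈ D, G.tail O e = Sum.inl v) ↔ ∃ e ∈ D, G.head O e = Sum.inl v) :
    G.Balanced O D := by
  intro v e he hev
  rcases (G.incident_iff_tail_or_head O e _).1 hev with h | h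
  · refine ⟨fun e' he' hev' hO => ht he' he ?_, ?_⟩
    · rw [h]
      rw [tail_eq_internal_iff] at h ⊢
      exact ⟨hev', hO ▸ h.2⟩
    · obtain ⟨e', he', h'⟩ := (hth v).1 ⟨e, he, h⟩
      rw [tail_eq_internal_iff] at h
      rw [head_eq_internal_iff] at h'
      refine ⟨e', he', h'.1, fun hO => ?_⟩
      have h1 := h.2
      have h2 := h'.2
      rw [hO] at h2
      cases hc : G.color v <;> simp_all
  · refine ⟨fun e' he' hev' hO => hh he' he ?_, ?_⟩
    · rw [h]
      rw [head_eq_internal_iff] at h ⊢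
      exact ⟨hev', hO ▸ h.2⟩
    · obtain ⟨e', he', h'⟩ := (hth v).2 ⟨e, he, h⟩
      rw [head_eq_internal_iff] at h
      rw [tail_eq_internal_iff] at h'
      refine ⟨e', he', h'.1, fun hO => ?_⟩
      have h1 := h.2
      have h2 := h'.2
      rw [hO] at h2
      cases hc : G.color v <;> simp_all

lemma Balanced.injOn_tail {O : Orientation E} {D : Set E} (hD : G.Balanced O D) :
    Set.InjOn (G.tail O) D := by
  intro e he e' he' h
  have h1 := incident_tail (G := G) O e
  have h2 := incident_tail (G := G) O e'
  rw [h] at h1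
  rcases ha : G.tail O e' with v | i
  · rw [ha] at h h1 h2
    have h3 := (tail_eq_internal_iff.1 ha).2
    have h4 := (tail_eq_internal_iff.1 h).2
    exact (hD v e' he' h2).1 e he h1 (Bool.eq_iff_iff.2 (h4.trans h3.symm))
  · rw [ha] at h1 h2
    exact h1.boundary_unique h2

lemma Balanced.injOn_head {O : Orientation E} {D : Set E} (hD : G.Balanced O D) :
    Set.InjOn (G.head O) D := by
  intro e he e' he' h
  have h1 := incident_head (G := G) O e
  have h2 := incident_head (G := G) O e'
  rw [h] at h1
  rcases ha : G.head O e' with v | i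
  · rw [ha] at h h1 h2
    have h3 := (head_eq_internal_iff.1 ha).2
    have h4 := (head_eq_internal_iff.1 h).2
    exact (hD v e' he' h2).1 e he h1 (Bool.eq_iff_iff.2 (h4.trans h3.symm))
  · rw [ha] at h1 h2
    exact h1.boundary_unique h2

lemma Balanced.exists_tail_iff {O : Orientation E} {D : Set E} (hD : G.Balanced O D) (v : V) :
    (∃ e ∈ D, G.tail O e = Sum.inl v) ↔ ∃ e ∈ D, G.head O e = Sum.inl v := by
  simp only [tail_eq_internal_iff, head_eq_internal_iff]
  constructor
  · rintro ⟨e, he, hev, h⟩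
    obtain ⟨e', he', hev', hO⟩ := (hD v e he hev).2
    refine ⟨e', he', hev', ?_⟩
    cases hc : G.color v <;> cases h1 : O e <;> cases h2 : O e' <;> simp_all
  · rintro ⟨e, he, hev, h⟩
    obtain ⟨e', he', hev', hO⟩ := (hD v e he hev).2
    refine ⟨e', he', hev', ?_⟩
    cases hc : G.color v <;> cases h1 : O e <;> cases h2 : O e' <;> simp_all

/-! ### Walks and cycles -/

/-- The vertex sequence of a walk, listed in two ways. Comparing the two listings yields the later
facts about end points. -/
lemma IsWalk.map_tail_append {O : Orientation E} {a b : V ⊕ Fin n} {p : List E}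
    (h : G.IsWalk O a p b) : p.map (G.tail O) ++ [b] = a :: p.map (G.head O) := by
  induction p generalizing a with
  | nil => simpa [IsWalk] using h.symm
  | cons e p ih =>
    obtain ⟨h₁, h₂⟩ := h
    simp [ih h₂, h₁]

lemma IsWalk.concat {O : Orientation E} {a b : V ⊕ Fin n} {p : List E} {e : E}
    (h : G.IsWalk O a p b) (he : G.tail O e = b) : G.IsWalk O a (p ++ [e]) (G.head O e) := by
  induction p generalizing a with
  | nil =>
    have h : a = b := h
    exact ⟨he.trans h.symm, rfl⟩
  | cons f p ih => exact ⟨h.1, ih h.2⟩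

lemma IsWalk.mem_map_head_or {O : Orientation E} {a b x : V ⊕ Fin n} {p : List E}
    (h : G.IsWalk O a p b) :
    (x ∈ p.map (G.tail O) ∨ x = b) ↔ (x = a ∨ x ∈ p.map (G.head O)) := by
  have := congrArg (x ∈ ·) h.map_tail_append
  simpa only [List.mem_append, List.mem_cons, List.not_mem_nil, or_false, eq_iff_iff] using this

lemma IsWalk.perm_of_closed {O : Orientation E} {a : V ⊕ Fin n} {p : List E}
    (h : G.IsWalk O a p a) : (p.map (G.tail O)).Perm (p.map (G.head O)) := by
  have h1 : (a :: p.map (G.tail O)).Perm (p.map (G.tail O) ++ [a]) :=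
    (List.perm_append_singleton a _).symm
  rw [h.map_tail_append] at h1
  exact h1.cons_inv

lemma IsCycle.nonempty {O : Orientation E} {C : Set E} (h : G.IsCycle O C) : C.Nonempty := by
  obtain ⟨a, p, hp, -, -, rfl⟩ := h
  exact List.exists_mem_of_ne_nil p hp

lemma IsCycle.balanced {O : Orientation E} {C : Set E} (h : G.IsCycle O C) :
    G.Balanced O C := by
  obtain ⟨a, p, hp, hw, hnd, rfl⟩ := h
  have hperm := hw.perm_of_closed
  refine balanced_of_tail_head (List.inj_on_of_nodup_map (hperm.nodup_iff.2 hnd))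
    (List.inj_on_of_nodup_map hnd) fun v => ?_
  simpa using hperm.mem_iff (a := Sum.inl v)

/-- On a closed walk every tail is also a head, which is impossible for a vertex with one edge. -/
lemma IsCycle.not_incident_boundary {O : Orientation E} {C : Set E} (h : G.IsCycle O C) {e : E}
    (he : e ∈ C) {i : Fin n} : ¬ G.Incident e (Sum.inr i) := by
  obtain ⟨a, p, hp, hw, hnd, rfl⟩ := h
  have hperm := hw.perm_of_closed
  intro hi
  rcases (G.incident_iff_tail_or_head O e _).1 hi with h | h
  · obtain ⟨e', -, h'⟩ := List.mem_map.1 (hperm.mem_iff.1 (List.mem_map.2 ⟨e, he, h⟩))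
    exact not_tail_head_boundary h h'
  · obtain ⟨e', -, h'⟩ := List.mem_map.1 (hperm.mem_iff.2 (List.mem_map.2 ⟨e, he, h⟩))
    exact not_tail_head_boundary h' h

lemma IsSelfAvoidingWalk.nonempty {O : Orientation E} {a b : V ⊕ Fin n} {C : Set E}
    (h : G.IsSelfAvoidingWalk O a b C) (hab : a ≠ b) : C.Nonempty := by
  obtain ⟨p, hw, -, rfl⟩ := h
  refine List.exists_mem_of_ne_nil p ?_
  rintro rfl
  exact hab hw

lemma IsSelfAvoidingWalk.balanced {O : Orientation E} {i j : Fin n} {C : Set E}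
    (h : G.IsSelfAvoidingWalk O (Sum.inr i) (Sum.inr j) C) : G.Balanced O C := by
  obtain ⟨p, hw, hnd, rfl⟩ := h
  have hnd' := hnd
  rw [← hw.map_tail_append] at hnd'
  refine balanced_of_tail_head (List.inj_on_of_nodup_map hnd'.of_append_left)
    (List.inj_on_of_nodup_map (List.nodup_cons.1 hnd).2) fun v => ?_
  simpa using hw.mem_map_head_or (x := Sum.inl v)

lemma IsSelfAvoidingWalk.tail_boundary {O : Orientation E} {a b : V ⊕ Fin n} {C : Set E}
    (h : G.IsSelfAvoidingWalk O a b C) {e : E} (he : e ∈ C) {k : Fin n}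
    (hk : G.tail O e = Sum.inr k) : Sum.inr k = a := by
  obtain ⟨p, hw, -, rfl⟩ := h
  rcases hw.mem_map_head_or.1 (Or.inl (List.mem_map.2 ⟨e, he, hk⟩)) with h | h
  · exact h
  · obtain ⟨e', -, h'⟩ := List.mem_map.1 h
    exact (not_tail_head_boundary hk h').elim

lemma IsSelfAvoidingWalk.head_boundary {O : Orientation E} {a b : V ⊕ Fin n} {C : Set E}
    (h : G.IsSelfAvoidingWalk O a b C) {e : E} (he : e ∈ C) {k : Fin n}
    (hk : G.head O e = Sum.inr k) : Sum.inr k = b := by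
  obtain ⟨p, hw, -, rfl⟩ := h
  rcases hw.mem_map_head_or.2 (Or.inr (List.mem_map.2 ⟨e, he, hk⟩)) with h | h
  · obtain ⟨e', -, h'⟩ := List.mem_map.1 h
    exact (not_tail_head_boundary h' hk).elim
  · exact h

lemma IsSelfAvoidingWalk.exists_tail {O : Orientation E} {a b : V ⊕ Fin n} {C : Set E}
    (h : G.IsSelfAvoidingWalk O a b C) (hC : C.Nonempty) : ∃ e ∈ C, G.tail O e = a := by
  obtain ⟨p, hw, -, rfl⟩ := h
  obtain ⟨e, he⟩ := hC
  cases p with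
  | nil => simp at he
  | cons f p => exact ⟨f, by simp, hw.1⟩

lemma IsSelfAvoidingWalk.ne {O : Orientation E} {a b : V ⊕ Fin n} {C : Set E}
    (h : G.IsSelfAvoidingWalk O a b C) (hC : C.Nonempty) : a ≠ b := by
  obtain ⟨e, he, hea⟩ := h.exists_tail hC
  obtain ⟨p, hw, hnd, rfl⟩ := h
  rw [← hw.map_tail_append] at hnd
  rintro rfl
  exact (List.nodup_append.1 hnd).2.2 a (List.mem_map.2 ⟨e, he, hea⟩) a (by simp) rfl

lemma IsSelfAvoidingWalk.exists_head {O : Orientation E} {a b : V ⊕ Fin n} {C : Set E}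
    (h : G.IsSelfAvoidingWalk O a b C) (hC : C.Nonempty) : ∃ e ∈ C, G.head O e = b := by
  have hab := h.ne hC
  obtain ⟨p, hw, hnd, rfl⟩ := h
  obtain ⟨e, he, h'⟩ := List.mem_map.1 ((hw.mem_map_head_or.1 (Or.inr rfl)).resolve_left hab.symm)
  exact ⟨e, he, h'⟩

/-! ### Decomposition of balanced sets -/

/-- Take a longest walk in `D` with distinct tails. If it is closed, it is a cycle. Otherwise an
internal end point would, by balance, allow an extension, so both ends lie on the boundary. -/
lemma Balanced.exists_component [Finite E] {O : Orientation E} {D : Set E}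
    (hD : G.Balanced O D) (hne : D.Nonempty) :
    ∃ C ⊆ D, C.Nonempty ∧ (G.IsCycle O C ∨
      ∃ i j, G.IsSelfAvoidingWalk O (Sum.inr i) (Sum.inr j) C) := by
  classical
  cases nonempty_fintype E
  let _ : BEq (V ⊕ Fin n) := instBEqOfDecidableEq
  let Q : List E → Prop := fun p =>
    (∃ a b, G.IsWalk O a p b) ∧ (∀ e ∈ p, e ∈ D) ∧ (p.map (G.tail O)).Nodup
  have hbdd : BddAbove {k | ∃ p, Q p ∧ p.length = k} := by
    refine ⟨Fintype.card E, ?_⟩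
    rintro _ ⟨p, hp, rfl⟩
    exact hp.2.2.of_map.length_le_card
  obtain ⟨e₀, he₀⟩ := hne
  have hQ₀ : Q [e₀] := ⟨⟨_, _, rfl, rfl⟩, by simpa using he₀, by simp⟩
  obtain ⟨p, ⟨⟨a, b, hw⟩, hpD, hnd⟩, hlen⟩ :=
    Nat.sSup_mem (s := {k | ∃ p, Q p ∧ p.length = k}) ⟨_, [e₀], hQ₀, rfl⟩ hbdd
  have hmax : ∀ q, Q q → q.length ≤ p.length := fun q hq => hlen ▸ le_csSup hbdd ⟨q, hq, rfl⟩
  have hp : p ≠ [] := by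
    rintro rfl
    simpa using hmax _ hQ₀
  have hndh : (p.map (G.head O)).Nodup :=
    hnd.of_map.map_on fun x hx y hy h => hD.injOn_head (hpD x hx) (hpD y hy) h
  refine ⟨{e | e ∈ p}, hpD, List.exists_mem_of_ne_nil p hp, ?_⟩
  by_cases hab : a = b
  · subst hab
    exact Or.inl ⟨a, p, hp, hw, hndh, rfl⟩
  right
  have hb : b ∈ p.map (G.head O) :=
    (hw.mem_map_head_or.1 (Or.inr rfl)).resolve_left (Ne.symm hab)
  have ha : a ∈ p.map (G.tail O) := (hw.mem_map_head_or.2 (Or.inl rfl)).resolve_right hab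
  -- Otherwise `b` would occur twice in the listing by tails but only once in the listing by heads.
  have hbt : b ∉ p.map (G.tail O) := by
    intro h
    have h1 := congrArg (List.count b) hw.map_tail_append
    rw [List.count_append, List.count_cons_of_ne hab, List.count_eq_one_of_mem hnd h,
      List.count_eq_one_of_mem hndh hb] at h1
    simp at h1
  have hah : a ∉ p.map (G.head O) := by
    intro h
    have h1 := congrArg (List.count a) hw.map_tail_append
    rw [List.count_append, List.count_cons_self, List.count_eq_one_of_mem hnd ha,
      List.count_eq_one_of_mem hndh h] at h1
    simp [Ne.symm hab] at h1
  obtain ⟨f, hf, hfa⟩ := List.mem_map.1 ha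
  obtain ⟨g, hg, hgb⟩ := List.mem_map.1 hb
  rcases b with v | j
  · obtain ⟨e, he, hev⟩ := (hD.exists_tail_iff v).2 ⟨g, hpD g hg, hgb⟩
    have hQ : Q (p ++ [e]) := by
      refine ⟨⟨_, _, hw.concat hev⟩, ?_, ?_⟩
      · intro x hx
        rcases List.mem_append.1 hx with h | h
        · exact hpD x h
        · rwa [List.mem_singleton.1 h]
      · rw [List.map_append, List.map_singleton, hev]
        exact hnd.append (by simp) (by simpa using hbt)
    simpa using hmax _ hQ
  rcases a with v | i
  · obtain ⟨e, he, hev⟩ := (hD.exists_tail_iff v).1 ⟨f, hpD f hf, hfa⟩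
    have hQ : Q (e :: p) := by
      refine ⟨⟨_, _, rfl, by rwa [hev]⟩, ?_, ?_⟩
      · intro x hx
        rcases List.mem_cons.1 hx with h | h
        · rwa [h]
        · exact hpD x h
      · rw [List.map_cons, List.nodup_cons]
        -- A repeated tail would force `e` itself to be in `p`, making its head `a` a head of `p`.
        refine ⟨fun h => hah ?_, hnd⟩
        obtain ⟨e', he', h'⟩ := List.mem_map.1 h
        obtain rfl := hD.injOn_tail (hpD e' he') he h'
        exact List.mem_map.2 ⟨e', he', hev⟩
    simpa using hmax _ hQ
  · exact ⟨i, j, p, hw, List.nodup_cons.2 ⟨hah, hndh⟩, rfl⟩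

/-- Split off one component and induct on the size: by `Balanced.mem_of_incident` the component
shares no vertex with the remainder, which is again balanced. -/
lemma Balanced.exists_decomposition [Finite E] {O : Orientation E} {D : Set E}
    (hD : G.Balanced O D) :
    ∃ F : Set (Set E), ⋃₀ F = D ∧
      (∀ C ∈ F, C.Nonempty ∧ (G.IsCycle O C ∨
        ∃ i j, G.IsSelfAvoidingWalk O (Sum.inr i) (Sum.inr j) C)) ∧
      (∀ C ∈ F, ∀ C' ∈ F, C ≠ C' → ∀ c ∈ C, ∀ d ∈ C', ∀ a,
        ¬ (G.Incident c a ∧ G.Incident d a)) := by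
  induction hk : D.ncard using Nat.strong_induction_on generalizing D with
  | _ k ih =>
  rcases D.eq_empty_or_nonempty with rfl | hne
  · exact ⟨∅, by simp⟩
  obtain ⟨C, hCD, hCne, hC⟩ := hD.exists_component hne
  have hCb : G.Balanced O C := by
    rcases hC with h | ⟨i, j, h⟩
    · exact h.balanced
    · exact h.balanced
  have hlt : (D \ C).ncard < k := by
    rw [← hk]
    exact Set.ncard_lt_ncard ((LE.le.sdiff_ssubset_of_nonempty hCD hCne))
  obtain ⟨F, hFD, hF, hdisj⟩ := ih _ hlt (hCb.diff hD hCD) rfl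
  have key : ∀ C' ∈ F, ∀ c ∈ C, ∀ d ∈ C', ∀ a, ¬ (G.Incident c a ∧ G.Incident d a) := by
    rintro C' hC' c hc d hd a ⟨h1, h2⟩
    have hd' : d ∈ D \ C := hFD ▸ ⟨C', hC', hd⟩
    exact hd'.2 (hCb.mem_of_incident hD hCD hc hd'.1 h1 h2)
  refine ⟨insert C F, by rw [Set.sUnion_insert, hFD, Set.union_sdiff_cancel hCD], ?_, ?_⟩
  · rintro C' (rfl | hC')
    · exact ⟨hCne, hC⟩
    · exact hF C' hC'
  · rintro C₁ (rfl | h₁) C₂ (rfl | h₂) hne c hc d hd a h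
    · exact hne rfl
    · exact key C₂ h₂ c hc d hd a h
    · exact key C₁ h₁ d hd c hc a h.symm
    · exact hdisj C₁ h₁ C₂ h₂ hne c hc d hd a h

/-! ### Flows and perfect orientations -/

lemma exists_flow_of_perfectOrientation [Finite E] {O O' : Orientation E}
    (hO : G.IsPerfectOrientation O) (hO' : G.IsPerfectOrientation O') :
    ∃ F, G.IsFlow O (G.sourceSet O') F ∧ ⋃₀ F = {e | O e ≠ O' e} := by
  obtain ⟨F, hFD, hF, hdisj⟩ := (hO.balanced_ne hO').exists_decomposition
  have hmem : ∀ C ∈ F, ∀ e ∈ C, O e ≠ O' e := fun C hC e he =>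
    (Set.ext_iff.1 hFD e).1 ⟨C, hC, he⟩
  have hsrc : ∀ C ∈ F, ∀ e ∈ C, ∀ i, G.tail O e = Sum.inr i →
      i ∈ G.sourceSet O \ G.sourceSet O' := by
    intro C hC e he i h
    have h1 : i ∈ G.sourceSet O := ⟨e, h⟩
    have h2 := (ne_iff_sourceSet (h ▸ incident_tail O e)).1 (hmem C hC e he)
    exact ⟨h1, fun h3 => h2 (iff_of_true h1 h3)⟩
  have hdst : ∀ C ∈ F, ∀ e ∈ C, ∀ i, G.head O e = Sum.inr i →
      i ∈ G.sourceSet O' \ G.sourceSet O := by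
    intro C hC e he i h
    have h1 : i ∉ G.sourceSet O := fun ⟨e', h'⟩ => not_tail_head_boundary h' h
    have h2 := (ne_iff_sourceSet (h ▸ incident_head O e)).1 (hmem C hC e he)
    exact ⟨by_contra fun h3 => h2 (iff_of_false h1 h3), h1⟩
  have hcover : ∀ i, ¬ (i ∈ G.sourceSet O ↔ i ∈ G.sourceSet O') →
      ∃ C ∈ F, ∃ e ∈ C, G.Incident e (Sum.inr i) ∧
        ∃ i j, G.IsSelfAvoidingWalk O (Sum.inr i) (Sum.inr j) C := by
    intro i hi
    obtain ⟨e, he⟩ := G.exists_incident_boundary i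
    obtain ⟨C, hC, heC⟩ := (Set.ext_iff.1 hFD e).2 ((ne_iff_sourceSet he).2 hi)
    exact ⟨C, hC, e, heC, he, (hF C hC).2.resolve_left fun h => h.not_incident_boundary heC he⟩
  refine ⟨F, ⟨fun C hC => ?_, hdisj, ?_, ?_⟩, hFD⟩
  · obtain ⟨hne, h | ⟨i, j, h⟩⟩ := hF C hC
    · exact Or.inl h
    · obtain ⟨e, he, hei⟩ := h.exists_tail hne
      obtain ⟨e', he', hej⟩ := h.exists_head hne
      exact Or.inr ⟨i, hsrc C hC e he i hei, j, hdst C hC e' he' j hej, h⟩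
  · rintro i ⟨hi, hi'⟩
    obtain ⟨C, hC, e, he, hei, i', j, h⟩ := hcover i fun h => hi' (h.1 hi)
    have := h.tail_boundary he ((mem_sourceSet_iff hei).1 hi)
    exact ⟨C, hC, j, this ▸ h⟩
  · rintro i ⟨hi, hi'⟩
    obtain ⟨C, hC, e, he, hei, i', j, h⟩ := hcover i fun h => hi' (h.2 hi)
    have := h.head_boundary he (((G.incident_iff_tail_or_head O e _).1 hei).resolve_left
      fun h => hi' ⟨e, h⟩)
    exact ⟨C, hC, i', this ▸ h⟩

lemma IsFlow.nonempty {O : Orientation E} {J : Set (Fin n)} {F : Set (Set E)}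
    (hF : G.IsFlow O J F) {C : Set E} (hC : C ∈ F) : C.Nonempty := by
  rcases hF.1 C hC with h | ⟨i, hi, j, hj, h⟩
  · exact h.nonempty
  · refine h.nonempty fun hij => ?_
    obtain rfl := Sum.inr_injective hij
    exact hi.2 hj.1

lemma IsFlow.balanced {O : Orientation E} {J : Set (Fin n)} {F : Set (Set E)}
    (hF : G.IsFlow O J F) : G.Balanced O (⋃₀ F) := by
  refine balanced_sUnion (fun C hC => ?_) hF.2.1
  rcases hF.1 C hC with h | ⟨i, -, j, -, h⟩
  · exact h.balanced
  · exact h.balanced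

/-- Only walks reach the boundary, and only at their end points. Hence reversing the flow turns the
source set into exactly `J`. -/
lemma IsFlow.mem_sUnion_iff {O : Orientation E} {J : Set (Fin n)} {F : Set (Set E)}
    (hF : G.IsFlow O J F) {e : E} {k : Fin n} (he : G.Incident e (Sum.inr k)) :
    e ∈ ⋃₀ F ↔ ¬ (k ∈ G.sourceSet O ↔ k ∈ J) := by
  constructor
  · rintro ⟨C, hC, heC⟩
    rcases hF.1 C hC with h | ⟨i, hi, j, hj, h⟩
    · exact absurd he (h.not_incident_boundary heC)
    · rcases (G.incident_iff_tail_or_head O e _).1 he with h' | h'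
      · obtain rfl := Sum.inr_injective (h.tail_boundary heC h')
        exact fun h => hi.2 (h.1 hi.1)
      · obtain rfl := Sum.inr_injective (h.head_boundary heC h')
        exact fun h => hj.2 (h.2 hj.1)
  · intro h
    by_cases hk : k ∈ G.sourceSet O
    · obtain ⟨C, hC, j, h'⟩ := hF.2.2.1 k ⟨hk, fun hJ => h (iff_of_true hk hJ)⟩
      obtain ⟨e', he', h''⟩ := h'.exists_tail (hF.nonempty hC)
      rw [he.boundary_unique (h'' ▸ incident_tail O e')]
      exact ⟨C, hC, he'⟩
    · obtain ⟨C, hC, j, h'⟩ := hF.2.2.2 k ⟨by_contra fun hJ => h (iff_of_false hk hJ), hk⟩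
      obtain ⟨e', he', h''⟩ := h'.exists_head (hF.nonempty hC)
      rw [he.boundary_unique (h'' ▸ incident_head O e')]
      exact ⟨C, hC, he'⟩

lemma IsFlow.sourceSet_reverseOn {O : Orientation E} {J : Set (Fin n)} {F : Set (Set E)}
    (hF : G.IsFlow O J F) : G.sourceSet (reverseOn O (⋃₀ F)) = J := by
  ext k
  obtain ⟨e, he⟩ := G.exists_incident_boundary k
  have h1 := hF.mem_sUnion_iff he
  rw [← ne_reverseOn_iff (O := O), ne_iff_sourceSet he] at h1
  tauto

/-- Reversing a white-to-black edge puts it into the matching (exponent `1`); reversing a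
black-to-white edge removes it (exponent `-1`). -/
lemma charVec_add_flowExponent (O : Orientation E) (F : Set (Set E)) :
    charVec (G.matchingOf O) + (fun e => (flowExponent O F e : ℝ)) =
      charVec (G.matchingOf (reverseOn O (⋃₀ F))) := by
  classical
  funext e
  rw [matchingOf_eq, matchingOf_eq]
  by_cases h : ∃ C ∈ F, e ∈ C <;> cases hO : O e <;>
    simp [charVec, flowExponent, reverseOn, h, hO]

/-! ### The matroid -/

/-- In a flow from one basis to the other, reverse only the walk that starts at `i`; its destination
is the element exchanged for `i`. -/
lemma exchangeProperty_sourceSet [Finite E] :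
    Matroid.ExchangeProperty fun B => ∃ O, G.IsPerfectOrientation O ∧ G.sourceSet O = B := by
  rintro _ _ ⟨O, hO, rfl⟩ ⟨O', hO', rfl⟩ i hi
  obtain ⟨F, hF, -⟩ := exists_flow_of_perfectOrientation hO hO'
  obtain ⟨C, hC, j, h⟩ := hF.2.2.1 i hi
  have hne := hF.nonempty hC
  obtain ⟨e, he, hei⟩ := h.exists_tail hne
  rcases hF.1 C hC with hc | ⟨i', hi', j', hj', h'⟩
  · exact absurd (hei ▸ incident_tail O e) (hc.not_incident_boundary he)
  obtain rfl := Sum.inr_injective (h'.tail_boundary he hei)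
  refine ⟨j', hj', reverseOn O C, h'.balanced.isPerfectOrientation hO, ?_⟩
  -- The single walk is itself a flow to the exchanged set, so `IsFlow.sourceSet_reverseOn` computes
  -- the new source set.
  have hflow : G.IsFlow O (insert j' (G.sourceSet O \ {i})) {C} := by
    have hij : i ≠ j' := fun h => hj'.2 (h ▸ hi.1)
    refine ⟨?_, ?_, ?_, ?_⟩
    · rintro _ rfl
      exact Or.inr ⟨i, ⟨hi.1, by simp [hij]⟩, j', ⟨by simp, hj'.2⟩, h'⟩
    · rintro _ rfl _ rfl h
      exact absurd rfl h
    · rintro k ⟨hk, hk'⟩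
      have : k = i := by
        by_contra hki
        exact hk' (Or.inr ⟨hk, hki⟩)
      exact ⟨C, rfl, j', this ▸ h'⟩
    · rintro k ⟨hk, hk'⟩
      have : k = j' := hk.resolve_right fun h => hk' h.1
      exact ⟨C, rfl, i, this ▸ h'⟩
  simpa using hflow.sourceSet_reverseOn

lemma exists_isPositroidOf [Finite E] (hG : G.PerfectlyOrientable) :
    ∃ M : Matroid (Fin n), IsPositroidOf M G := by
  obtain ⟨O, hO⟩ := hG
  exact ⟨Matroid.ofIsBaseOfFinite Set.finite_univ
    (fun B => ∃ O, G.IsPerfectOrientation O ∧ G.sourceSet O = B) ⟨_, O, hO, rfl⟩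
    exchangeProperty_sourceSet (fun _ _ => Set.subset_univ _), rfl, fun _ => Iff.rfl⟩

/-! ### The projection -/

variable (G) in
open Classical in
/-- The coefficients of the projection. If `b_i` is joined to a white vertex, the `i`-th coordinate
is `x_e` for the edge `e` at `b_i`. If `b_i` is joined to a black vertex `u`, it is the sum of
`x_e` over the other edges at `u`. -/
noncomputable def projectionMatrix : Matrix (Fin n) E ℝ := fun i e =>
  if G.blackEnd e = Sum.inr i ∨ (G.whiteEnd e ≠ Sum.inr i ∧
    ∃ e' u, G.whiteEnd e' = Sum.inr i ∧ G.blackEnd e' = Sum.inl u ∧ G.blackEnd e = Sum.inl u)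
  then 1 else 0

variable (G) in
/-- The projection from `ℝ^E` to `ℝ^n`. -/
noncomputable def projection [Fintype E] : (E → ℝ) →ₗ[ℝ] (Fin n → ℝ) :=
  G.projectionMatrix.mulVecLin

/-- If `b_i` is joined to a white vertex, it is a source when its edge `e` is matched. If it is
joined to a black vertex `u`, it is a source when `e` is unmatched; the coordinate `1 - x_e` then
equals the sum over the other edges at `u`, which keeps the map linear. -/
lemma projection_charVec_matchingOf [Fintype E] {O : Orientation E}
    (hO : G.IsPerfectOrientation O) :
    G.projection (charVec (G.matchingOf O)) = charVec (G.sourceSet O) := by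
  classical
  rw [isPerfectOrientation_iff] at hO
  rw [matchingOf_eq]
  funext i
  obtain ⟨e, he⟩ := G.exists_incident_boundary i
  have hi := mem_sourceSet_iff (O := O) he
  simp only [projection, Matrix.mulVecLin_apply, Matrix.mulVec, dotProduct]
  by_cases hb : G.blackEnd e = Sum.inr i
  · have hw : ∀ e', G.whiteEnd e' ≠ Sum.inr i := by
      intro e' h
      obtain rfl := he.boundary_unique (Or.inr h : G.Incident e' _)
      obtain ⟨v, hv⟩ := G.exists_internal e
      simp_all
    rw [Finset.sum_eq_single e]
    · cases h : O e <;>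
        simp [projectionMatrix, hb, charVec, hi, tail, h, hw]
    · intro e' _ hne
      have : G.blackEnd e' ≠ Sum.inr i := fun h =>
        hne (he.boundary_unique (Or.inl h : G.Incident e' _)).symm
      simp [projectionMatrix, this, hw]
    · simp
  · have hw : G.whiteEnd e = Sum.inr i := he.resolve_left hb
    have hb' : ∀ e', G.blackEnd e' ≠ Sum.inr i := fun e' h =>
      hb (by rwa [he.boundary_unique (Or.inl h : G.Incident e' _)])
    have hw' : ∀ e', G.whiteEnd e' = Sum.inr i ↔ e' = e := fun e' =>
      ⟨fun h => (he.boundary_unique (Or.inr h : G.Incident e' _)).symm, fun h => h ▸ hw⟩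
    obtain ⟨u, hu⟩ : ∃ u, G.blackEnd e = Sum.inl u := by
      obtain ⟨v, hv⟩ := G.exists_internal e
      exact ⟨v, hv.resolve_right (by simp [hw])⟩
    obtain ⟨e₀, ⟨h₀, hO₀⟩, huniq⟩ := hO u
    have hcol := G.color_blackEnd e u hu
    have hu₀ := blackEnd_eq_of_incident h₀ hcol
    -- The row is supported on edges at `u`, of which only `e₀` is matched.
    rw [Finset.sum_eq_single e₀]
    · have hM : G.projectionMatrix i e₀ = if e₀ = e then 0 else 1 := by
        by_cases h : e₀ = e
        · simp [projectionMatrix, h, hb, hw]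
        · simp [projectionMatrix, h, hw', hu, hu₀]
      by_cases h : e₀ = e
      · subst h
        simp [hM, charVec, hi, tail, hO₀, hb]
      · have hOe : O e = false := by
          by_contra h'
          exact h (huniq e ⟨Or.inl hu, by simpa using h'⟩).symm
        simp [hM, h, charVec, hi, tail, hO₀, hOe, hw]
    · intro e' _ hne
      by_cases hOe : O e' = true
      · have : G.blackEnd e' ≠ Sum.inl u := fun h => hne (huniq e' ⟨Or.inl h, hOe⟩)
        simp [projectionMatrix, hb', hw', hu, this]
      · simp [charVec, hOe]
    · simp

end BoundaryGraph

/-! ### Polytopes -/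

lemma charVec_mem_Icc {ι : Type*} (s : Set ι) : charVec s ∈ Set.Icc (0 : ι → ℝ) 1 := by
  classical
  constructor <;> intro i <;> by_cases h : i ∈ s <;> simp [charVec, h]

lemma charVec_mem_extremePoints_Icc {ι : Type*} (s : Set ι) :
    charVec s ∈ (Set.Icc (0 : ι → ℝ) 1).extremePoints ℝ := by
  classical
  rw [mem_extremePoints_iff_left]
  refine ⟨charVec_mem_Icc s, ?_⟩
  rintro x ⟨hx0, hx1⟩ y ⟨hy0, hy1⟩ ⟨a, b, ha, hb, hab, h⟩
  funext i
  have hi := congrFun h i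
  have h1 := hx0 i
  have h2 := hx1 i
  have h3 := hy0 i
  have h4 := hy1 i
  simp only [Pi.add_apply, Pi.smul_apply, smul_eq_mul, Pi.zero_apply, Pi.one_apply]
    at hi h1 h2 h3 h4
  by_cases his : i ∈ s
  · simp only [charVec, his, Set.indicator_of_mem, Pi.one_apply] at hi ⊢
    nlinarith
  · simp only [charVec, his, not_false_eq_true, Set.indicator_of_notMem] at hi ⊢
    nlinarith [mul_nonneg hb.le h3]

/-- The fiber of a polytope over an extreme point of the target is spanned by the generators in
this fiber. -/
lemma fiber_convexHull_eq {X Y : Type*} [AddCommGroup X] [Module ℝ X] [AddCommGroup Y] [Module ℝ Y]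
    (f : X →ₗ[ℝ] Y) {S : Set X} {A : Set Y} (hA : Convex ℝ A) (hSA : Set.MapsTo f S A) {y : Y}
    (hy : y ∈ A.extremePoints ℝ) :
    {x | x ∈ convexHull ℝ S ∧ f x = y} = convexHull ℝ {x | x ∈ S ∧ f x = y} := by
  rw [mem_extremePoints] at hy
  apply Set.Subset.antisymm
  · rintro x ⟨hx, hxy⟩
    -- This set contains `S`, so convexity suffices. A proper convex combination lying over `y` has
    -- both ends over `y` by extremality; over other points the implication is vacuous.
    have hT : Convex ℝ {x | f x ∈ A ∧ (f x = y → x ∈ convexHull ℝ {x | x ∈ S ∧ f x = y})} := by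
      rw [convex_iff_forall_pos]
      rintro u ⟨hu, hu'⟩ v ⟨hv, hv'⟩ a b ha hb hab
      refine ⟨by simpa using hA hu hv ha.le hb.le hab, fun h => ?_⟩
      obtain ⟨h1, h2⟩ := hy.2 _ hu _ hv ⟨a, b, ha, hb, hab, by simpa using h⟩
      exact convex_convexHull ℝ _ (hu' h1) (hv' h2) ha.le hb.le hab
    have hST : S ⊆ {x | f x ∈ A ∧ (f x = y → x ∈ convexHull ℝ {x | x ∈ S ∧ f x = y})} :=
      fun s hs => ⟨hSA hs, fun h => subset_convexHull ℝ _ ⟨hs, h⟩⟩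
    exact (convexHull_min hST hT hx).2 hxy
  · refine convexHull_min (fun x hx => ⟨subset_convexHull ℝ _ hx.1, hx.2⟩) ?_
    exact (convex_convexHull ℝ S).inter ((convex_singleton y).linear_preimage f)

lemma extremePoints_matroidPolytope {α : Type*} (M : Matroid α) :
    (matroidPolytope M).extremePoints ℝ = {y | ∃ J, M.IsBase J ∧ y = charVec J} := by
  refine Set.Subset.antisymm extremePoints_convexHull_subset ?_
  rintro _ ⟨J, hJ, rfl⟩
  refine inter_extremePoints_subset_extremePoints_of_subset (convexHull_min ?_ (convex_Icc 0 1))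
    ⟨subset_convexHull ℝ _ ⟨J, hJ, rfl⟩, charVec_mem_extremePoints_Icc J⟩
  rintro _ ⟨B, -, rfl⟩
  exact charVec_mem_Icc B

/-! ### The matching polytope: its image and its fibers -/

namespace BoundaryGraph

variable {n : ℕ} {V E : Type*} {G : BoundaryGraph n V E}

lemma matchingPolytope_eq : G.matchingPolytope =
    convexHull ℝ {x | ∃ O, G.IsPerfectOrientation O ∧ x = charVec (G.matchingOf O)} := by
  unfold matchingPolytope
  congr 1
  ext x
  constructor
  · rintro ⟨N, hN, rfl⟩
    obtain ⟨O, ⟨hO, rfl⟩, -⟩ := existsUnique_orientation_of_matching hN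
    exact ⟨O, hO, rfl⟩
  · rintro ⟨O, hO, rfl⟩
    exact ⟨_, isAlmostPerfectMatching_matchingOf hO, rfl⟩

lemma projection_image_matchingPolytope [Fintype E] {M : Matroid (Fin n)}
    (hM : IsPositroidOf M G) : G.projection '' G.matchingPolytope = matroidPolytope M := by
  rw [matchingPolytope_eq, matroidPolytope, LinearMap.image_convexHull]
  congr 1
  ext y
  constructor
  · rintro ⟨_, ⟨O, hO, rfl⟩, rfl⟩
    exact ⟨_, (hM.2 _).2 ⟨O, hO, rfl⟩, projection_charVec_matchingOf hO⟩
  · rintro ⟨B, hB, rfl⟩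
    obtain ⟨O, hO, rfl⟩ := (hM.2 _).1 hB
    exact ⟨_, ⟨O, hO, rfl⟩, projection_charVec_matchingOf hO⟩

/-- Each coefficient counts the flows with that exponent, so nothing cancels. -/
lemma coeff_pluckerLaurent_ne_zero_iff [Fintype E] {O : Orientation E} {J : Set (Fin n)}
    {m : E → ℤ} :
    (G.pluckerLaurent O J).coeff m ≠ 0 ↔ ∃ F, G.IsFlow O J F ∧ flowExponent O F = m := by
  classical
  simp only [pluckerLaurent, AddMonoidAlgebra.coeff_sum, AddMonoidAlgebra.coeff_single,
    Finsupp.finsetSum_apply, Finsupp.single_apply]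
  rw [Finset.sum_boole]
  simp [Finset.filter_eq_empty_iff]

open Pointwise in
-- Both sides are convex hulls, and their generators agree by the passage between flows and perfect
-- orientations. Extremality is used in the unit cube, so `J` may be any set.
lemma fiber_matchingPolytope_eq [Fintype E] {O : Orientation E} (hO : G.IsPerfectOrientation O)
    (J : Set (Fin n)) :
    {x | x ∈ G.matchingPolytope ∧ G.projection x = charVec J} =
      (fun z => charVec (G.matchingOf O) + z) '' newtonPolytope (G.pluckerLaurent O J) := by
  rw [matchingPolytope_eq, fiber_convexHull_eq G.projection (convex_Icc 0 1) ?_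
    (charVec_mem_extremePoints_Icc J)]
  -- Written as `+ᵥ`, the translation commutes with the convex hull.
  · change _ = charVec (G.matchingOf O) +ᵥ newtonPolytope (G.pluckerLaurent O J)
    rw [newtonPolytope, ← convexHull_vadd]
    congr 1
    ext x
    simp only [coeff_pluckerLaurent_ne_zero_iff]
    constructor
    · rintro ⟨⟨O', hO', rfl⟩, hJ⟩
      rw [projection_charVec_matchingOf hO'] at hJ
      have hJ' : G.sourceSet O' = J := Set.indicator_one_inj ℝ hJ
      obtain ⟨F, hF, hFD⟩ := exists_flow_of_perfectOrientation hO hO'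
      refine ⟨_, ⟨_, ⟨F, hJ' ▸ hF, rfl⟩, rfl⟩, ?_⟩
      change charVec (G.matchingOf O) + _ = _
      rw [charVec_add_flowExponent, hFD, reverseOn_setOf_ne]
    · rintro ⟨_, ⟨_, ⟨F, hF, rfl⟩, rfl⟩, rfl⟩
      have hO' := hF.balanced.isPerfectOrientation hO
      have h := charVec_add_flowExponent (G := G) O F
      refine ⟨⟨_, hO', h⟩, ?_⟩
      change G.projection (charVec (G.matchingOf O) + _) = _
      rw [h, projection_charVec_matchingOf hO', hF.sourceSet_reverseOn]
  · rintro _ ⟨O', hO', rfl⟩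
    rw [projection_charVec_matchingOf hO']
    exact charVec_mem_Icc _

end BoundaryGraph

end PlaneBipartite

theorem mainTheorem8 {n : ℕ} {V E : Type*} [Finite V] [Fintype E]
    (G : PlaneBipartite.PlaneBipartiteGraph n V E) (hG : G.PerfectlyOrientable) :
    ∃ M : Matroid (Fin n), PlaneBipartite.BoundaryGraph.IsPositroidOf M G.toBoundaryGraph ∧
    ∃ Ψ : (E → ℝ) →ₗ[ℝ] (Fin n → ℝ),
      -- the projection maps `P(G)` onto `Q(M_G)`
      Ψ '' G.matchingPolytope = PlaneBipartite.matroidPolytope M ∧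
      -- a matching goes to the source set of the corresponding perfect orientation
      (∀ N : Set E, G.IsAlmostPerfectMatching N →
        ∃! O, G.IsPerfectOrientation O ∧ G.matchingOf O = N) ∧
      (∀ O, G.IsPerfectOrientation O →
        G.IsAlmostPerfectMatching (G.matchingOf O) ∧
        Ψ (PlaneBipartite.charVec (G.matchingOf O)) =
          PlaneBipartite.charVec (G.sourceSet O)) ∧
      -- if the boundary vertices are black, this is the set of matched boundary vertices
      (G.BoundaryBlack → ∀ N : Set E, G.IsAlmostPerfectMatching N →
        Ψ (PlaneBipartite.charVec N) = PlaneBipartite.charVec (G.matchedBoundary N)) ∧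
      -- the vertices of `Q(M_G)`
      (PlaneBipartite.matroidPolytope M).extremePoints ℝ =
        {y | ∃ J, M.IsBase J ∧ y = PlaneBipartite.charVec J} ∧
      -- the fibers over the vertices, up to the translation by the vector of the matching of `O`
      (∀ O, G.IsPerfectOrientation O → ∀ J, M.IsBase J →
        {x | x ∈ G.matchingPolytope ∧ Ψ x = PlaneBipartite.charVec J} =
          (fun z => PlaneBipartite.charVec (G.matchingOf O) + z) ''
            PlaneBipartite.newtonPolytope (G.pluckerLaurent O J)) := by
  open PlaneBipartite BoundaryGraph in
  obtain ⟨M, hM⟩ := exists_isPositroidOf hG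
  refine ⟨M, hM, projection G.toBoundaryGraph, projection_image_matchingPolytope hM,
    fun N hN => existsUnique_orientation_of_matching hN,
    fun O hO => ⟨isAlmostPerfectMatching_matchingOf hO, projection_charVec_matchingOf hO⟩,
    fun hB N hN => ?_, extremePoints_matroidPolytope M,
    fun O hO J _ => fiber_matchingPolytope_eq hO J⟩
  obtain ⟨O, ⟨hO, rfl⟩, -⟩ := existsUnique_orientation_of_matching hN
  rw [projection_charVec_matchingOf hO, sourceSet_eq_matchedBoundary hB]
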